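/- Let $d,n\ge 0$ be integers, let $\mathcal X=[0,1]^d$, let $p$ be a probability density on $\mathcal X$, and put $Q[f]=\int_{\mathcal X} f(x)p(x)\,dx$. Let $k:\mathcal X\times\mathcal X\to\mathbb R$ be a measurable covariance function (symmetric, positive semidefinite) with $\int k(x,x)p(x)\,dx<\infty$, let $\sigma>0$ and $x_1,\dots,x_n,\tilde x\in\mathcal X$. Put $K_n=(k(x_i,x_j))_{ij}$, $\mathbf k_n(x)=(k(x,x_i))_{i}$ and, for $y\in\mathbb R^n$, $\alpha_n=(K_n+\sigma^2 I)^{-1}y$, $$m_n(x)=\mathbf k_n(x)^T\alpha_n,\qquad k_n(x,x')=k(x,x')-\mathbf k_n(x)^T(K_n+\sigma^2I)^{-1}\mathbf k_n(x'),$$ $$\epsilon(x)=\int k(x,x')p(x')\,dx',\quad \epsilon_n=(\epsilon(x_i))_i,\quad \sigma_0^2=\iint k(x,x')p(x)p(x')\,dx\,dx',\quad \nu(\tilde x)=\epsilon(\tilde x)-\epsilon_n^T(K_n+\sigma^2I)^{-1}\mathbf k_n(\tilde x).$$ All Gaussian processes below are jointly measurable in $(x,\omega)$, and normal distributions may have variance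 $0$. (1) Current belief. Let $$\mu_1=\epsilon_n^T\alpha_n,\qquad \sigma_1^2=\sigma_0^2-\epsilon_n^T(K_n+\sigma^2I)^{-1}\epsilon_n .$$ Then $\mu_1=\int m_n p$ and $\sigma_1^2=\iint k_n(x,x')p(x)p(x')\,dx\,dx'$. If $f\sim \mathrm{GP}(0,k)$ and $Y_i=f(x_i)+e_i$ with $e_1,\dots,e_n$ i.i.d. $\mathcal N(0,\sigma^2)$ and independent of $f$, then $f p$ is almost surely integrable and the conditional distribution of $Q[f]$ given $Y=y$ is $\mathcal N(\mu_1,\sigma_1^2)$ for almost every $y$ with respect to the law of $Y$. Moreover, for every $y\in\mathbb R^n$, if $g$ is distributed as the posterior process $\mathrm{GP}(m_n,k_n)$, then $gp$ is almost surely integrable and $Q[g]\sim\mathcal N(\mu_1,\sigma_1^2)$. (2) Belief after a hypothetical observation. Let $\tilde m_{n+1},\tilde k_{n+1}$ be the posterior mean and covariance functions formed as above from the $n+1$ data $(x_i,y_i)_{i\le n},(\tilde x,\tilde y)$, and let $$\mu_2=\mu_1+\frac{\nu(\tilde x)}{k_n(\tilde x,\tilde x)+\sigma^2}\,(\tilde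 y-m_n(\tilde x)),\qquad \sigma_2^2=\sigma_1^2-\frac{\nu(\tilde x)^2}{k_n(\tilde x,\tilde x)+\sigma^2}.$$ Then $$\tilde m_{n+1}(x)=m_n(x)+k_n(x,\tilde x)\frac{\tilde y-m_n(\tilde x)}{k_n(\tilde x,\tilde x)+\sigma^2},\qquad \tilde k_{n+1}(x,x')=k_n(x,x')-\frac{k_n(x,\tilde x)k_n(\tilde x,x')}{k_n(\tilde x,\tilde x)+\sigma^2},$$ $\mu_2=\int \tilde m_{n+1}p$, and $\sigma_2^2=\iint \tilde k_{n+1}(x,x')p(x)p(x')\,dx\,dx'$. If $f\sim\mathrm{GP}(0,k)$ and $Y$, $\tilde Y$ are observations of $f$ at $x_1,\dots,x_n$ and $\tilde x$ with i.i.d. $\mathcal N(0,\sigma^2)$ noise independent of $f$, then the conditional distribution of $Q[f]$ given $Y=y,\tilde Y=\tilde y$ is $\mathcal N(\mu_2,\sigma_2^2)$ for almost every $(y,\tilde y)$ with respect to the law of $(Y,\tilde Y)$; and for every $y,\tilde y$, if $g$ is distributed as $\mathrm{GP}(\tilde m_{n+1},\tilde k_{n+1})$, then $gp$ is almost surely integrable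 and $Q[g]\sim\mathcal N(\mu_2,\sigma_2^2)$. (3) Squared-exponential kernel, uniform density. Let $p=1$ and $k(x,x')=s^2\exp\{-\frac12\sum_{j=1}^d (x_j-x_j')^2/\ell_j^2\}$ with $s\in\mathbb R$ and $\ell_j>0$. Then $p$ and $k$ satisfy the assumptions above, and $$\epsilon(x)=s^2\left(\frac{\pi}{2}\right)^{d/2}\prod_{j=1}^d \ell_j\left[\operatorname{erf}\left(\frac{1-x_j}{\sqrt2\,\ell_j}\right)-\operatorname{erf}\left(\frac{-x_j}{\sqrt2\,\ell_j}\right)\right],$$ $$\sigma_0^2=s^2\prod_{j=1}^d 2\ell_j^2\sqrt\pi\left\{-\frac1{\sqrt\pi}+\frac1{\sqrt\pi}\exp\left(-\frac1{2\ell_j^2}\right)+\frac1{\sqrt2\,\ell_j}\operatorname{erf}\left(\frac1{\sqrt2\,\ell_j}\right)\right\}.$$ -/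

import Mathlib

open MeasureTheory ProbabilityTheory Matrix

noncomputable section

namespace GPQoI

/-- The input domain `[0, 1]^d`. Its `volume` is `d`-dimensional Lebesgue measure on the cube. -/
abbrev Cube (d : ℕ) : Type := Fin d → unitInterval

/-- The error function. -/
def erf (z : ℝ) : ℝ := 2 / Real.sqrt Real.pi * ∫ t in (0 : ℝ)..z, Real.exp (-t ^ 2)

/-- The squared-exponential kernel with signal strength `s ^ 2` and lengthscales `ℓ j`. -/
def sqExpKernel {d : ℕ} (s : ℝ) (ℓ : Fin d → ℝ) (x x' : Cube d) : ℝ :=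
  s ^ 2 * Real.exp (-(1 / 2) * ∑ j, ((x j : ℝ) - (x' j : ℝ)) ^ 2 / ℓ j ^ 2)

/-- `p` is a probability density function on the cube. -/
structure IsDensity {d : ℕ} (p : Cube d → ℝ) : Prop where
  measurable : Measurable p
  nonneg : ∀ x, 0 ≤ p x
  integral_eq_one : ∫ x, p x = 1

/-- The Gram matrix `(k (x_i, x_j))_{ij}`. -/
def gram {d n : ℕ} (k : Cube d → Cube d → ℝ) (X : Fin n → Cube d) : Matrix (Fin n) (Fin n) ℝ :=
  Matrix.of fun i j => k (X i) (X j)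

/-- `k` is a measurable covariance function (symmetric and positive semidefinite) with
`∫ k(x, x) p(x) dx < ∞`, i.e. a centred process with covariance `k` is square integrable
against `p` in mean. -/
structure IsCovarianceFunction {d : ℕ} (k : Cube d → Cube d → ℝ) (p : Cube d → ℝ) : Prop where
  measurable : Measurable (Function.uncurry k)
  posSemidef : ∀ (m : ℕ) (z : Fin m → Cube d), (gram k z).PosSemidef
  integrable_diag : Integrable fun x => k x x * p x

/-- The quantity of interest `Q[f] = ∫ f(x) p(x) dx`. -/
def qoi {d : ℕ} (p : Cube d → ℝ) (f : Cube d → ℝ) : ℝ := ∫ x, f x * p x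

/-- `f` is (a jointly measurable version of) a Gaussian process with mean function `m` and
covariance function `k`. -/
structure IsGP {d : ℕ} {Ω : Type*} [MeasurableSpace Ω] (f : Cube d → Ω → ℝ) (P : Measure Ω)
    (m : Cube d → ℝ) (k : Cube d → Cube d → ℝ) : Prop where
  measurable : Measurable (Function.uncurry f)
  isGaussianProcess : IsGaussianProcess f P
  mean : ∀ x, ∫ ω, f x ω ∂P = m x
  covariance : ∀ x x', cov[f x, f x'; P] = k x x'

/-- `Y i` is an observation of `f` at `X i`, contaminated by Gaussian noise of variance `σ ^ 2`;
the noise variables are independent of one another and of the whole process `f`. -/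
structure IsNoisyObservation {d n : ℕ} {Ω : Type*} [MeasurableSpace Ω] (f : Cube d → Ω → ℝ)
    (P : Measure Ω) (σ : ℝ) (X : Fin n → Cube d) (Y : Fin n → Ω → ℝ) : Prop where
  noise_law : ∀ i, HasLaw (fun ω => Y i ω - f (X i) ω) (gaussianReal 0 (σ ^ 2).toNNReal) P
  noise_indep : iIndepFun (fun i ω => Y i ω - f (X i) ω) P
  noise_indep_process : IndepFun (fun ω i => Y i ω - f (X i) ω) (fun ω x => f x ω) P

/-- The measure `ν` is the normal distribution with mean `m` and variance `v ≥ 0`. -/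
def IsNormal (ν : Measure ℝ) (m v : ℝ) : Prop := 0 ≤ v ∧ ν = gaussianReal m v.toNNReal

section Posterior

variable {d n : ℕ} (k : Cube d → Cube d → ℝ) (p : Cube d → ℝ) (σ : ℝ) (X : Fin n → Cube d)

/-- `k_n(x) = (k(x, x_1), …, k(x, x_n))`. -/
def kvec (x : Cube d) : Fin n → ℝ := fun i => k x (X i)

/-- `(K_n + σ² I_n)⁻¹`. -/
def precision : Matrix (Fin n) (Fin n) ℝ := (gram k X + σ ^ 2 • (1 : Matrix (Fin n) (Fin n) ℝ))⁻¹

/-- `α_n = (K_n + σ² I_n)⁻¹ Y_n`. -/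
def alpha (y : Fin n → ℝ) : Fin n → ℝ := precision k σ X *ᵥ y

/-- The posterior mean function `m_n`. -/
def postMean (y : Fin n → ℝ) (x : Cube d) : ℝ := kvec k X x ⬝ᵥ alpha k σ X y

/-- The posterior covariance function `k_n`. -/
def postCov (x x' : Cube d) : ℝ := k x x' - kvec k X x ⬝ᵥ (precision k σ X *ᵥ kvec k X x')

/-- `ε(x) = ∫ k(x, x') p(x') dx'`. -/
def eps (x : Cube d) : ℝ := ∫ x', k x x' * p x'

/-- `ε_n = (ε(x_1), …, ε(x_n))`. -/
def epsVec : Fin n → ℝ := fun i => eps k p (X i)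

/-- `σ_0² = ∫∫ k(x, x') p(x) p(x') dx dx'`. -/
def sigma0Sq : ℝ := ∫ x, ∫ x', k x x' * p x * p x'

/-- `μ_1 = ε_nᵀ α_n`. -/
def mu1 (y : Fin n → ℝ) : ℝ := epsVec k p X ⬝ᵥ alpha k σ X y

/-- `σ_1² = σ_0² - ε_nᵀ (K_n + σ² I_n)⁻¹ ε_n`. -/
def sigma1Sq : ℝ := sigma0Sq k p - epsVec k p X ⬝ᵥ (precision k σ X *ᵥ epsVec k p X)

/-- `ν(x̃) = ε(x̃) - ε_nᵀ (K_n + σ² I_n)⁻¹ k_n(x̃)`. -/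
def nu (xt : Cube d) : ℝ := eps k p xt - epsVec k p X ⬝ᵥ (precision k σ X *ᵥ kvec k X xt)

/-- `μ_2(x̃, ỹ) = μ_1 + ν(x̃) / (k_n(x̃, x̃) + σ²) * (ỹ - m_n(x̃))`. -/
def mu2 (y : Fin n → ℝ) (xt : Cube d) (yt : ℝ) : ℝ :=
  mu1 k p σ X y + nu k p σ X xt / (postCov k σ X xt xt + σ ^ 2) * (yt - postMean k σ X y xt)

/-- `σ_2²(x̃) = σ_1² - ν(x̃)² / (k_n(x̃, x̃) + σ²)`. -/
def sigma2Sq (xt : Cube d) : ℝ :=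
  sigma1Sq k p σ X - nu k p σ X xt ^ 2 / (postCov k σ X xt xt + σ ^ 2)

end Posterior

/-- The list `X` of length `n` with `a` appended at the end. -/
def append {n : ℕ} {α : Type*} (X : Fin n → α) (a : α) : Fin (n + 1) → α :=
  Fin.snoc (α := fun _ => α) X a

end GPQoI

end

open GPQoI

/-! Let π be the probability measure p dx. As k(x, x) is π-integrable, Tonelli makes f square
integrable on the product space, so Q[f] is an L² variable, and means and covariances pass through
the integral over x. It is Gaussian because it lies in the closed linear span of the f(x): by
Fubini, whatever is orthogonal to every f(x) is orthogonal to Q, and Gaussian laws form a closed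
subset of L² (`isClosed_setOf_hasGaussianLaw`, `hasGaussianLaw_of_orthogonal`). The posterior
process is treated in the same way, its mean being in L²(π) and its variance in L¹(π).

Conditioning is linear regression (`exists_residual`). With c = (K_n + σ²I)⁻¹ε_n, the residual R = Q
− cᵀY is uncorrelated with Y; the closure argument, applied to f together with the noise, makes (R,
Y) jointly Gaussian, so R is independent of Y. Hence Q given Y = y is R shifted by cᵀy = μ₁
(`condDistrib_add_of_indepFun`).

A hypothetical observation is the same statement with n + 1 data. The bordered linear system is
solved explicitly, its pivot being the Schur complement k_n(x̃, x̃) + σ² > 0, and integrating the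
resulting updates gives μ₂ and σ₂².

The squared-exponential kernel is a product of one-dimensional Gaussian characteristic functions,
hence positive semidefinite; its integrals factor over coordinates and have erf antiderivatives. -/

open scoped ENNReal NNReal RealInnerProductSpace

/-! ### Gaussian laws are closed in L² -/

section GaussianClosure

variable {Ω : Type*} [MeasurableSpace Ω] {P : Measure Ω} [IsProbabilityMeasure P]

omit [IsProbabilityMeasure P] in
lemma charFun_map_coeFn_eq (t : ℝ) (Z : Lp ℝ 2 P) :
    charFun (P.map Z) t = ∫ ω, Complex.exp (t * Z ω * Complex.I) ∂P := by
  rw [charFun_apply_real, integral_map (Lp.aestronglyMeasurable Z).aemeasurable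
    (by fun_prop)]

/-- Since |exp(ia) − exp(ib)| ≤ |a − b|, the map is |t|-Lipschitz for the L¹ distance, which the L²
distance dominates under a probability measure. -/
lemma continuous_charFun_map (t : ℝ) :
    Continuous fun Z : Lp ℝ 2 P => charFun (P.map Z) t := by
  have hint : ∀ Z : Lp ℝ 2 P, Integrable (fun ω => Complex.exp (t * Z ω * Complex.I)) P := by
    intro Z
    refine Integrable.of_bound (C := 1) ?_ (ae_of_all _ fun ω => ?_)
    · have := (Lp.aestronglyMeasurable Z).aemeasurable
      fun_prop
    · rw [← Complex.ofReal_mul, Complex.norm_exp_ofReal_mul_I]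
  refine LipschitzWith.continuous (K := ‖t‖₊) (LipschitzWith.of_dist_le_mul fun Z W => ?_)
  rw [charFun_map_coeFn_eq, charFun_map_coeFn_eq, dist_eq_norm, ← integral_sub (hint Z) (hint W)]
  have hZW : MemLp (fun ω => ‖(Z - W) ω‖) 2 P := (Lp.memLp (Z - W)).norm
  calc ‖∫ ω, (Complex.exp (t * Z ω * Complex.I) - Complex.exp (t * W ω * Complex.I)) ∂P‖
      ≤ ∫ ω, ‖t‖ * ‖(Z - W) ω‖ ∂P := by
        refine norm_integral_le_of_norm_le ((hZW.integrable one_le_two).const_mul _) ?_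
        filter_upwards [Lp.coeFn_sub Z W] with ω hω
        rw [hω]
        have h1 : Complex.exp (t * Z ω * Complex.I) - Complex.exp (t * W ω * Complex.I)
            = Complex.exp (t * W ω * Complex.I) *
              (Complex.exp (Complex.I * ((t * (Z ω - W ω) : ℝ) : ℂ)) - 1) := by
          rw [mul_sub, ← Complex.exp_add]
          push_cast
          ring_nf
        rw [h1, norm_mul, ← Complex.ofReal_mul, Complex.norm_exp_ofReal_mul_I, one_mul]
        refine (Real.norm_exp_I_mul_ofReal_sub_one_le).trans ?_
        rw [norm_mul, Pi.sub_apply]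
    _ = ‖t‖ * ∫ ω, ‖(Z - W) ω‖ ∂P := integral_const_mul _ _
    _ ≤ ‖t‖ * dist Z W := by
        refine mul_le_mul_of_nonneg_left ?_ (norm_nonneg _)
        rw [dist_eq_norm, Lp.norm_def, integral_norm_eq_lintegral_enorm (Lp.aestronglyMeasurable _)]
        refine ENNReal.toReal_mono (Lp.eLpNorm_ne_top _) ?_
        rw [← eLpNorm_one_eq_lintegral_enorm]
        exact eLpNorm_le_eLpNorm_of_exponent_le one_le_two (Lp.aestronglyMeasurable _)

lemma continuous_integral_coeFn_L2 : Continuous fun Z : Lp ℝ 2 P => ∫ ω, Z ω ∂P := by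
  have h : (fun Z : Lp ℝ 2 P => ∫ ω, Z ω ∂P) = fun Z =>
      ⟪indicatorConstLp 2 MeasurableSet.univ (measure_ne_top P _) (1 : ℝ), Z⟫ := by
    ext Z
    rw [L2.inner_indicatorConstLp_one, setIntegral_univ]
  rw [h]
  fun_prop

lemma continuous_variance_coeFn_L2 : Continuous fun Z : Lp ℝ 2 P => Var[Z; P] := by
  have h : (fun Z : Lp ℝ 2 P => Var[Z; P]) = fun Z => ‖Z‖ ^ 2 - (∫ ω, Z ω ∂P) ^ 2 := by
    ext Z
    rw [variance_eq_sub (Lp.memLp Z), ← real_inner_self_eq_norm_sq, L2.inner_def]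
    simp [pow_two]
  rw [h]
  exact (continuous_norm.pow 2).sub (continuous_integral_coeFn_L2.pow 2)

/-- For each t, being Gaussian is one equation between the characteristic function and an expression
in the mean and variance, and both sides are continuous on L². -/
lemma isClosed_setOf_hasGaussianLaw : IsClosed {Z : Lp ℝ 2 P | HasGaussianLaw Z P} := by
  have h : {Z : Lp ℝ 2 P | HasGaussianLaw Z P} = ⋂ t : ℝ, {Z : Lp ℝ 2 P | charFun (P.map Z) t =
      Complex.exp ((t * ∫ ω, Z ω ∂P : ℝ) * Complex.I - (t ^ 2 * Var[Z; P] : ℝ) / 2)} := by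
    ext Z
    rw [Set.mem_ofPred_eq,
      hasGaussianLaw_iff_charFun_map_eq (Lp.aestronglyMeasurable Z).aemeasurable]
    simp only [Set.mem_iInter, Set.mem_ofPred_eq]
    refine forall_congr' fun t => ?_
    have h1 : (fun ω => ⟪t, Z ω⟫) = fun ω => t * Z ω := by ext; simp [mul_comm]
    rw [h1, integral_const_mul, variance_const_mul]
  rw [h]
  refine isClosed_iInter fun t => isClosed_eq (continuous_charFun_map t) ?_
  have := continuous_integral_coeFn_L2 (P := P)
  have := continuous_variance_coeFn_L2 (P := P)
  fun_prop

/-- A square-integrable random variable in the closed linear span of a Gaussian process, which is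
expressed by orthogonality, has a Gaussian law. -/
lemma ProbabilityTheory.IsGaussianProcess.hasGaussianLaw_of_orthogonal {T : Type*} {F : T → Ω → ℝ}
    (hF : IsGaussianProcess F P) {Z : Ω → ℝ} (hZ : MemLp Z 2 P)
    (h : ∀ g : Ω → ℝ, MemLp g 2 P → (∀ t, ∫ ω, g ω * F t ω ∂P = 0) → ∫ ω, g ω * Z ω ∂P = 0) :
    HasGaussianLaw Z P := by
  have hF2 : ∀ t, MemLp (F t) 2 P := fun t => (hF.hasGaussianLaw_eval t).memLp_two
  set V : Submodule ℝ (Lp ℝ 2 P) := Submodule.span ℝ (Set.range fun t => (hF2 t).toLp) with hV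
  -- The closure of V is its double orthogonal complement, so `h` says exactly that Z lies in it.
  have hmem : hZ.toLp ∈ V.topologicalClosure := by
    rw [← Submodule.orthogonal_orthogonal_eq_closure, Submodule.mem_orthogonal]
    intro g hg
    rw [L2.inner_def]
    have h1 := h g (Lp.memLp g) fun t => ?_
    · rw [← h1]
      refine integral_congr_ae ?_
      filter_upwards [hZ.coeFn_toLp] with ω hω
      simp [hω, mul_comm]
    · have h2 := (Submodule.mem_orthogonal _ _).1 hg _ (Submodule.subset_span ⟨t, rfl⟩)
      rw [L2.inner_def] at h2
      rw [← h2]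
      refine integral_congr_ae ?_
      filter_upwards [(hF2 t).coeFn_toLp] with ω hω
      simp [hω]
  have hsub : (V : Set (Lp ℝ 2 P)) ⊆ {Z : Lp ℝ 2 P | HasGaussianLaw Z P} := by
    intro g hg
    obtain ⟨c, rfl⟩ := (Finsupp.mem_span_range_iff_exists_finsupp).1 hg
    refine ((hF.smul c).hasGaussianLaw_fun_sum (I := c.support)).congr ?_
    rw [Finsupp.sum]
    have h1 : ∀ᵐ ω ∂P, ∀ t ∈ c.support, (c t • (hF2 t).toLp : Lp ℝ 2 P) ω = c t • F t ω := by
      rw [Filter.eventually_all_finset]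
      intro t _
      filter_upwards [Lp.coeFn_smul (c t) (hF2 t).toLp, (hF2 t).coeFn_toLp] with ω h2 h3
      rw [h2, Pi.smul_apply, h3]
    filter_upwards [Lp.coeFn_fun_finsetSum c.support fun t => (c t • (hF2 t).toLp : Lp ℝ 2 P), h1]
      with ω h2 h3
    rw [h2]
    exact Finset.sum_congr rfl fun t ht => (h3 t ht).symm
  exact (isClosed_setOf_hasGaussianLaw.closure_subset_iff.2 hsub hmem).congr hZ.coeFn_toLp

end GaussianClosure

/-! ### Pathwise integrals of square-integrable processes -/

section ProcessIntegral

variable {Ω S : Type*} [MeasurableSpace Ω] [MeasurableSpace S] {P : Measure Ω}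
  [IsProbabilityMeasure P] {π : Measure S} [IsProbabilityMeasure π] {f : S → Ω → ℝ}

omit [IsProbabilityMeasure π] in
lemma memLp_two_uncurry (hfm : Measurable (Function.uncurry f)) (hf : ∀ x, MemLp (f x) 2 P)
    (hint : Integrable (fun x => ∫ ω, f x ω ^ 2 ∂P) π) :
    MemLp (Function.uncurry f) 2 (π.prod P) := by
  rw [memLp_two_iff_integrable_sq hfm.aestronglyMeasurable,
    integrable_prod_iff (hfm.pow_const 2).aestronglyMeasurable]
  refine ⟨ae_of_all _ fun x => (hf x).integrable_sq, ?_⟩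
  simpa [Function.uncurry] using hint

lemma memLp_two_integral_left (hf : MemLp (Function.uncurry f) 2 (π.prod P)) :
    MemLp (fun ω => ∫ x, f x ω ∂π) 2 P := by
  have hmeas : AEStronglyMeasurable (fun ω => ∫ x, f x ω ∂π) P :=
    hf.1.prod_swap.integral_prod_right'
  rw [memLp_two_iff_integrable_sq hmeas]
  have hsq := hf.integrable_sq
  refine hsq.integral_prod_right.mono' (hmeas.pow 2) ?_
  filter_upwards [hsq.prod_left_ae, hf.1.prodMk_right] with ω h1 h2
  have h3 : MemLp (fun x => f x ω) 2 π := (memLp_two_iff_integrable_sq h2).2 h1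
  -- Nonnegative variance in x is Jensen's inequality (∫ f dπ)² ≤ ∫ f² dπ.
  have h4 := variance_nonneg (fun x => f x ω) π
  rw [variance_eq_sub h3] at h4
  rw [Real.norm_of_nonneg (sq_nonneg _)]
  simpa using h4

lemma integral_mul_integral_left (hf : MemLp (Function.uncurry f) 2 (π.prod P))
    {g : Ω → ℝ} (hg : MemLp g 2 P) :
    ∫ ω, g ω * ∫ x, f x ω ∂π ∂P = ∫ x, ∫ ω, g ω * f x ω ∂P ∂π := by
  have h1 : Integrable (Function.uncurry fun x ω => g ω * f x ω) (π.prod P) :=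
    (hg.comp_snd π).integrable_mul hf
  rw [integral_integral_swap h1]
  simp_rw [integral_const_mul]

lemma covariance_integral_left (hf : MemLp (Function.uncurry f) 2 (π.prod P))
    (hf' : ∀ x, MemLp (f x) 2 P) {g : Ω → ℝ} (hg : MemLp g 2 P) :
    cov[fun ω => ∫ x, f x ω ∂π, g; P] = ∫ x, cov[f x, g; P] ∂π := by
  have h1 : Integrable (Function.uncurry fun x ω => g ω * f x ω) (π.prod P) :=
    (hg.comp_snd π).integrable_mul hf
  have h2 : Integrable (Function.uncurry f) (π.prod P) := hf.integrable one_le_two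
  rw [covariance_eq_sub (memLp_two_integral_left hf) hg]
  simp_rw [fun x => covariance_eq_sub (hf' x) hg]
  rw [integral_sub, integral_mul_const, integral_integral_swap h2, mul_comm (_ : Ω → ℝ) g]
  · congr 1
    simp_rw [mul_comm (f _) g]
    exact integral_mul_integral_left hf hg
  · simp_rw [mul_comm (f _) g]
    exact h1.integral_prod_left
  · exact h2.integral_prod_left.mul_const _

end ProcessIntegral

/-! ### Joint Gaussianity and conditional laws -/

section Independence

lemma ProbabilityTheory.IsGaussianProcess.sumElim_of_indepFun {Ω S T : Type*} [MeasurableSpace Ω]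
    [Finite T] {P : Measure Ω} {f : S → Ω → ℝ} {e : T → Ω → ℝ} (hf : IsGaussianProcess f P)
    (he : HasGaussianLaw (fun ω t => e t ω) P)
    (h : IndepFun (fun ω s => f s ω) (fun ω t => e t ω) P) :
    IsGaussianProcess (Sum.elim f e) P where
  hasGaussianLaw I := by
    classical
    have := Fintype.ofFinite T
    have h1 : HasGaussianLaw (fun ω => (I.toLeft.restrict (f · ω), fun t => e t ω)) P := by
      refine IndepFun.hasGaussianLaw (hf.hasGaussianLaw I.toLeft) he ?_
      exact h.comp (φ := fun x => I.toLeft.restrict x) (ψ := id)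
        (Finset.measurable_restrict _) measurable_id
    -- A finite-dimensional marginal of the joined family is a linear image of the independent
    -- Gaussian pair in `h1`.
    let L : (I.toLeft → ℝ) × (T → ℝ) →L[ℝ] (I → ℝ) := ContinuousLinearMap.pi fun i =>
      match i with
      | ⟨Sum.inl s, hs⟩ =>
        (ContinuousLinearMap.proj (R := ℝ) (φ := fun _ : I.toLeft => ℝ)
          ⟨s, Finset.mem_toLeft.2 hs⟩).comp (.fst ℝ _ _)
      | ⟨Sum.inr t, _⟩ =>
        (ContinuousLinearMap.proj (R := ℝ) (φ := fun _ : T => ℝ) t).comp (.snd ℝ _ _)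
    refine (h1.map_fun L).congr (ae_of_all _ fun ω => ?_)
    ext ⟨i, hi⟩
    cases i <;> rfl

/-- Cramér–Wold: every linear functional on ℝ × ℝ^ι is determined by its values on the basis
vectors, which serve as a and b. -/
lemma hasGaussianLaw_prodMk_of_forall {Ω ι : Type*} [Fintype ι] [MeasurableSpace Ω] {P : Measure Ω}
    [IsProbabilityMeasure P] {R : Ω → ℝ} {Y : ι → Ω → ℝ} (hR : AEMeasurable R P)
    (hY : ∀ i, AEMeasurable (Y i) P)
    (h : ∀ (a : ℝ) (b : ι → ℝ), HasGaussianLaw (fun ω => a * R ω + ∑ i, b i * Y i ω) P) :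
    HasGaussianLaw (fun ω => (R ω, fun i => Y i ω)) P where
  isGaussian_map := by
    classical
    have hm : AEMeasurable (fun ω => (R ω, fun i => Y i ω)) P :=
      hR.prodMk (aemeasurable_pi_lambda _ hY)
    refine isGaussian_of_map_eq_gaussianReal fun L => ?_
    have h1 : (fun ω => L (R ω, fun i => Y i ω)) = fun ω =>
        L (1, 0) * R ω + ∑ i, L (0, Pi.single i 1) * Y i ω := by
      ext ω
      have h2 : ((R ω, fun i => Y i ω) : ℝ × (ι → ℝ)) =
          R ω • (1, 0) + ∑ i, Y i ω • ((0 : ℝ), (Pi.single i 1 : ι → ℝ)) := by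
        ext j
        · simp [Prod.fst_sum]
        · simp [Prod.snd_sum, Finset.sum_apply, Pi.single_apply]
      rw [h2, map_add, map_sum, map_smul]
      simp_rw [map_smul, smul_eq_mul, mul_comm]
    rw [AEMeasurable.map_map_of_aemeasurable (by fun_prop) hm]
    have h3 := h (L (1, 0)) fun i => L (0, Pi.single i 1)
    rw [← h1] at h3
    exact ⟨_, _, h3.map_eq_gaussianReal⟩

/-- Independence leaves the law of R unchanged given W = z, so Q is only translated by c(z).
Uniqueness of the disintegration reduces this to identifying the joint law of (W, Q). -/
lemma condDistrib_add_of_indepFun {Ω β : Type*} [MeasurableSpace Ω] [MeasurableSpace β]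
    {P : Measure Ω} [IsProbabilityMeasure P] {R Q : Ω → ℝ} {W : Ω → β} {c : β → ℝ}
    {v : ℝ≥0} (hR : HasLaw R (gaussianReal 0 v) P) (hW : AEMeasurable W P) (hc : Measurable c)
    (hRW : IndepFun R W P) (hQ : Q =ᵐ[P] fun ω => R ω + c (W ω)) :
    ∀ᵐ z ∂(P.map W), condDistrib Q W P z = gaussianReal (c z) v := by
  let κ : Kernel β ℝ :=
    ⟨fun z => gaussianReal (c z) v, by
      have : (fun z => gaussianReal (c z) v) =
        (fun q : ℝ × ℝ≥0 => gaussianReal q.1 q.2) ∘ fun z => (c z, v) := rfl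
      rw [this]
      exact measurable_gaussianReal.comp (by fun_prop)⟩
  have : IsMarkovKernel κ := ⟨fun z => by change IsProbabilityMeasure (gaussianReal _ _); infer_instance⟩
  have hRm := hR.aemeasurable
  have hQm : AEMeasurable Q P := (hRm.add (hc.comp_aemeasurable hW)).congr hQ.symm
  refine condDistrib_ae_eq_of_measure_eq_compProd W hQm (κ := κ) ?_
  have := Measure.isProbabilityMeasure_map hW
  have h1 : P.map (fun ω => (W ω, R ω)) = (P.map W).prod (gaussianReal 0 v) := by
    rw [(indepFun_iff_map_prod_eq_prod_map_map hW hRm).1 hRW.symm, hR.map_eq]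
  have h2 : P.map (fun ω => (W ω, Q ω)) =
      ((P.map W).prod (gaussianReal 0 v)).map fun z => (z.1, z.2 + c z.1) := by
    rw [← h1, AEMeasurable.map_map_of_aemeasurable (by fun_prop) (by fun_prop)]
    refine Measure.map_congr ?_
    filter_upwards [hQ] with ω hω
    simp [hω]
  rw [h2]
  refine Measure.ext fun s hs => ?_
  rw [Measure.map_apply (by fun_prop) hs, Measure.compProd_apply hs,
    Measure.prod_apply (by measurability)]
  refine lintegral_congr fun z => ?_
  have h3 : κ z = (gaussianReal 0 v).map (· + c z) := by
    rw [gaussianReal_map_add_const, zero_add]; rfl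
  rw [h3, Measure.map_apply (by fun_prop) (by measurability)]
  rfl

end Independence

namespace GPQoI

/-! ### The probability measure p dx -/

section DensityMeasure

variable {d : ℕ} {p : Cube d → ℝ}

/-- The measure on the cube with Lebesgue density `p`. -/
noncomputable def densityMeasure {d : ℕ} (p : Cube d → ℝ) : Measure (Cube d) :=
  volume.withDensity fun x => ENNReal.ofReal (p x)

lemma IsDensity.integral_densityMeasure (hp : IsDensity p) (f : Cube d → ℝ) :
    ∫ x, f x ∂densityMeasure p = ∫ x, f x * p x := by
  rw [densityMeasure, integral_withDensity_eq_integral_toReal_smul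
    hp.measurable.ennreal_ofReal (by simp)]
  simp [ENNReal.toReal_ofReal (hp.nonneg _), mul_comm]

lemma IsDensity.integrable_densityMeasure_iff (hp : IsDensity p) (f : Cube d → ℝ) :
    Integrable f (densityMeasure p) ↔ Integrable fun x => f x * p x := by
  rw [densityMeasure, integrable_withDensity_iff hp.measurable.ennreal_ofReal (by simp)]
  simp [ENNReal.toReal_ofReal (hp.nonneg _)]

lemma IsDensity.isProbabilityMeasure (hp : IsDensity p) :
    IsProbabilityMeasure (densityMeasure p) := by
  constructor
  rw [densityMeasure, withDensity_apply _ MeasurableSet.univ, Measure.restrict_univ,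
    ← ofReal_integral_eq_lintegral_ofReal _ (ae_of_all _ hp.nonneg), hp.integral_eq_one,
    ENNReal.ofReal_one]
  by_contra h
  have := hp.integral_eq_one
  rw [integral_undef h] at this
  exact zero_ne_one this

lemma IsDensity.integral_integral_densityMeasure (hp : IsDensity p) (K : Cube d → Cube d → ℝ) :
    ∫ x, ∫ x', K x x' * p x * p x' = ∫ x, ∫ x', K x x' ∂densityMeasure p ∂densityMeasure p := by
  simp_rw [hp.integral_densityMeasure]
  congr 1 with x
  rw [← integral_mul_const]
  congr 1 with x'
  ring

end DensityMeasure

/-! ### Covariance functions and integrals of the posterior moments -/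

section Covariance

variable {d n : ℕ} {k : Cube d → Cube d → ℝ} {p : Cube d → ℝ} {σ : ℝ}

lemma IsCovarianceFunction.symm (hk : IsCovarianceFunction k p) (x x' : Cube d) :
    k x x' = k x' x := by
  have h := (hk.posSemidef 2 ![x, x']).isHermitian.apply 1 0
  simpa [gram] using h

/-- Cauchy–Schwarz for k, read off from the determinant of a 2 × 2 Gram matrix. Together with
`integrable_diag` it supplies all the integrability needed for k. -/
lemma IsCovarianceFunction.sq_le (hk : IsCovarianceFunction k p) (x x' : Cube d) :
    k x x' ^ 2 ≤ k x x * k x' x' := by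
  have h := (hk.posSemidef 2 ![x, x']).det_nonneg
  rw [det_fin_two] at h
  simp only [gram, of_apply, cons_val_zero, cons_val_one, hk.symm x' x] at h
  nlinarith

lemma IsCovarianceFunction.nonneg (hk : IsCovarianceFunction k p) (x : Cube d) : 0 ≤ k x x :=
  (hk.posSemidef 1 ![x]).diag_nonneg (i := 0)

lemma IsCovarianceFunction.abs_le (hk : IsCovarianceFunction k p) (x x' : Cube d) :
    |k x x'| ≤ k x x + k x' x' := by
  have h0 := hk.nonneg x
  have h1 := hk.nonneg x'
  refine abs_le_of_sq_le_sq ?_ (by positivity)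
  nlinarith [hk.sq_le x x', mul_nonneg h0 h1]

lemma IsCovarianceFunction.integrable_diag_densityMeasure (hk : IsCovarianceFunction k p)
    (hp : IsDensity p) : Integrable (fun x => k x x) (densityMeasure p) :=
  (hp.integrable_densityMeasure_iff _).2 hk.integrable_diag

lemma IsCovarianceFunction.integrable_uncurry (hk : IsCovarianceFunction k p) (hp : IsDensity p) :
    Integrable (Function.uncurry k) ((densityMeasure p).prod (densityMeasure p)) := by
  have := hp.isProbabilityMeasure
  have h := hk.integrable_diag_densityMeasure hp
  exact ((h.comp_fst _).add (h.comp_snd _)).mono' hk.measurable.aestronglyMeasurable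
    (ae_of_all _ fun z => hk.abs_le z.1 z.2)

lemma IsCovarianceFunction.memLp_two_left (hk : IsCovarianceFunction k p) (hp : IsDensity p)
    (x' : Cube d) : MemLp (fun x => k x x') 2 (densityMeasure p) := by
  have hm : Measurable fun x => k x x' := hk.measurable.comp (by fun_prop : Measurable fun x => (x, x'))
  rw [memLp_two_iff_integrable_sq hm.aestronglyMeasurable]
  refine ((hk.integrable_diag_densityMeasure hp).mul_const (k x' x')).mono'
    (hm.pow_const 2).aestronglyMeasurable (ae_of_all _ fun x => ?_)
  rw [Real.norm_of_nonneg (sq_nonneg _)]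
  exact hk.sq_le x x'

lemma IsCovarianceFunction.integrable_left (hk : IsCovarianceFunction k p) (hp : IsDensity p)
    (x' : Cube d) : Integrable (fun x => k x x') (densityMeasure p) :=
  have := hp.isProbabilityMeasure
  (hk.memLp_two_left hp x').integrable one_le_two

lemma eps_eq (hp : IsDensity p) (x : Cube d) : eps k p x = ∫ x', k x x' ∂densityMeasure p :=
  (hp.integral_densityMeasure _).symm

lemma IsCovarianceFunction.eps_eq_left (hk : IsCovarianceFunction k p) (hp : IsDensity p)
    (x : Cube d) : eps k p x = ∫ x', k x' x ∂densityMeasure p := by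
  simp_rw [eps_eq hp, hk.symm x]

lemma IsCovarianceFunction.integrable_eps (hk : IsCovarianceFunction k p) (hp : IsDensity p) :
    Integrable (eps k p) (densityMeasure p) := by
  have := hp.isProbabilityMeasure
  simp_rw [funext (eps_eq (k := k) hp)]
  exact (hk.integrable_uncurry hp).integral_prod_left

lemma sigma0Sq_eq (hp : IsDensity p) :
    sigma0Sq k p = ∫ x, eps k p x ∂densityMeasure p := by
  simp_rw [sigma0Sq, hp.integral_integral_densityMeasure, eps_eq hp]

lemma IsCovarianceFunction.posDef (hk : IsCovarianceFunction k p) (hσ : 0 < σ)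
    (X : Fin n → Cube d) : (gram k X + σ ^ 2 • (1 : Matrix (Fin n) (Fin n) ℝ)).PosDef :=
  PosDef.posSemidef_add (hk.posSemidef n X) (PosDef.one.smul (by positivity))

lemma IsCovarianceFunction.mulVec_precision (hk : IsCovarianceFunction k p) (hσ : 0 < σ)
    (X : Fin n → Cube d) (v : Fin n → ℝ) :
    (gram k X + σ ^ 2 • (1 : Matrix (Fin n) (Fin n) ℝ)) *ᵥ (precision k σ X *ᵥ v) = v := by
  rw [mulVec_mulVec, precision, mul_nonsing_inv _ (isUnit_iff_isUnit_det _ |>.1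
    (hk.posDef hσ X).isUnit), one_mulVec]

lemma IsCovarianceFunction.precision_mulVec_eq (hk : IsCovarianceFunction k p) (hσ : 0 < σ)
    (X : Fin n → Cube d) {v w : Fin n → ℝ}
    (h : (gram k X + σ ^ 2 • (1 : Matrix (Fin n) (Fin n) ℝ)) *ᵥ w = v) :
    precision k σ X *ᵥ v = w := by
  rw [← h, mulVec_mulVec, precision, nonsing_inv_mul _ (isUnit_iff_isUnit_det _ |>.1
    (hk.posDef hσ X).isUnit), one_mulVec]

lemma IsCovarianceFunction.dotProduct_precision_comm (hk : IsCovarianceFunction k p) (hσ : 0 < σ)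
    (X : Fin n → Cube d) (v w : Fin n → ℝ) :
    v ⬝ᵥ (precision k σ X *ᵥ w) = w ⬝ᵥ (precision k σ X *ᵥ v) := by
  have h : (precision k σ X)ᵀ = precision k σ X := by
    have := (hk.posDef hσ X).inv.isHermitian
    rwa [IsHermitian, conjTranspose_eq_transpose_of_trivial] at this
  rw [dotProduct_mulVec, ← mulVec_transpose, h, dotProduct_comm]

lemma integral_kvec_dotProduct (hk : IsCovarianceFunction k p) (hp : IsDensity p)
    (X : Fin n → Cube d) (v : Fin n → ℝ) :
    ∫ x, kvec k X x ⬝ᵥ v ∂densityMeasure p = epsVec k p X ⬝ᵥ v := by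
  simp only [dotProduct, kvec, epsVec]
  rw [integral_finsetSum _ fun i _ => (hk.integrable_left hp (X i)).mul_const _]
  simp_rw [integral_mul_const, hk.eps_eq_left hp]

lemma integrable_kvec_dotProduct (hk : IsCovarianceFunction k p) (hp : IsDensity p)
    (X : Fin n → Cube d) (v : Fin n → ℝ) :
    Integrable (fun x => kvec k X x ⬝ᵥ v) (densityMeasure p) := by
  simp only [dotProduct, kvec]
  exact integrable_finsetSum _ fun i _ => (hk.integrable_left hp (X i)).mul_const _

lemma memLp_two_postMean (hk : IsCovarianceFunction k p) (hp : IsDensity p)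
    (X : Fin n → Cube d) (y : Fin n → ℝ) :
    MemLp (postMean k σ X y) 2 (densityMeasure p) := by
  change MemLp (fun x => ∑ i, k x (X i) * alpha k σ X y i) 2 _
  exact memLp_finsetSum _ fun i _ => (hk.memLp_two_left hp (X i)).mul_const _

lemma integral_postMean (hk : IsCovarianceFunction k p) (hp : IsDensity p)
    (X : Fin n → Cube d) (y : Fin n → ℝ) :
    ∫ x, postMean k σ X y x ∂densityMeasure p = mu1 k p σ X y :=
  integral_kvec_dotProduct hk hp X _

lemma IsCovarianceFunction.postCov_comm (hk : IsCovarianceFunction k p) (hσ : 0 < σ)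
    (X : Fin n → Cube d) (x x' : Cube d) : postCov k σ X x x' = postCov k σ X x' x := by
  rw [postCov, postCov, hk.symm, hk.dotProduct_precision_comm hσ]

lemma integral_postCov_left (hk : IsCovarianceFunction k p) (hp : IsDensity p)
    (X : Fin n → Cube d) (x' : Cube d) :
    ∫ x, postCov k σ X x x' ∂densityMeasure p = nu k p σ X x' := by
  simp only [postCov]
  rw [integral_sub (hk.integrable_left hp x') (integrable_kvec_dotProduct hk hp X _),
    integral_kvec_dotProduct hk hp, ← hk.eps_eq_left hp, nu]

lemma integrable_postCov_left (hk : IsCovarianceFunction k p) (hp : IsDensity p)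
    (X : Fin n → Cube d) (x' : Cube d) :
    Integrable (fun x => postCov k σ X x x') (densityMeasure p) :=
  (hk.integrable_left hp x').sub (integrable_kvec_dotProduct hk hp X _)

lemma integrable_postCov_diag (hk : IsCovarianceFunction k p) (hp : IsDensity p)
    (X : Fin n → Cube d) : Integrable (fun x => postCov k σ X x x) (densityMeasure p) := by
  refine (hk.integrable_diag_densityMeasure hp).sub ?_
  simp only [dotProduct, mulVec, kvec]
  refine integrable_finsetSum _ fun i _ => ?_
  simp only [Finset.mul_sum]
  refine integrable_finsetSum _ fun j _ => ?_
  refine Integrable.congr ?_ (ae_of_all _ fun x => (mul_left_comm (precision k σ X i j) _ _))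
  -- Each term of the quadratic form is a product of two L² sections of k.
  exact ((hk.memLp_two_left hp (X i)).integrable_mul (hk.memLp_two_left hp (X j))).const_mul _

lemma integral_nu (hk : IsCovarianceFunction k p) (hp : IsDensity p) (hσ : 0 < σ)
    (X : Fin n → Cube d) :
    ∫ x, nu k p σ X x ∂densityMeasure p = sigma1Sq k p σ X := by
  simp only [nu, hk.dotProduct_precision_comm hσ X (epsVec k p X)]
  rw [integral_sub (hk.integrable_eps hp) (integrable_kvec_dotProduct hk hp X _),
    integral_kvec_dotProduct hk hp, ← sigma0Sq_eq hp, sigma1Sq]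

lemma integrable_nu (hk : IsCovarianceFunction k p) (hp : IsDensity p) (hσ : 0 < σ)
    (X : Fin n → Cube d) : Integrable (nu k p σ X) (densityMeasure p) := by
  have h : nu k p σ X = fun x => eps k p x - kvec k X x ⬝ᵥ (precision k σ X *ᵥ epsVec k p X) := by
    ext x
    rw [nu, hk.dotProduct_precision_comm hσ]
  rw [h]
  exact (hk.integrable_eps hp).sub (integrable_kvec_dotProduct hk hp X _)

lemma integral_postCov_right (hk : IsCovarianceFunction k p) (hp : IsDensity p) (hσ : 0 < σ)
    (X : Fin n → Cube d) (x : Cube d) :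
    ∫ x', postCov k σ X x x' ∂densityMeasure p = nu k p σ X x := by
  rw [← integral_postCov_left hk hp]
  exact integral_congr_ae (ae_of_all _ fun x' => hk.postCov_comm hσ X x x')

lemma integral_integral_postCov (hk : IsCovarianceFunction k p) (hp : IsDensity p) (hσ : 0 < σ)
    (X : Fin n → Cube d) :
    ∫ x, ∫ x', postCov k σ X x x' ∂densityMeasure p ∂densityMeasure p = sigma1Sq k p σ X := by
  simp_rw [integral_postCov_right hk hp hσ, integral_nu hk hp hσ]

/-! ### Updating the posterior by one observation -/

section Append

variable {α : Type*}

@[simp] lemma append_castSucc (v : Fin n → α) (a : α) (i : Fin n) :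
    append v a i.castSucc = v i := Fin.snoc_castSucc ..

@[simp] lemma append_last (v : Fin n → α) (a : α) : append v a (Fin.last n) = a :=
  Fin.snoc_last ..

lemma append_dotProduct_append (v w : Fin n → ℝ) (a b : ℝ) :
    append v a ⬝ᵥ append w b = v ⬝ᵥ w + a * b := by
  simp [dotProduct, Fin.sum_univ_castSucc]

lemma kvec_append (X : Fin n → Cube d) (xt x : Cube d) :
    kvec k (append X xt) x = append (kvec k X x) (k x xt) := by
  ext i
  cases i using Fin.lastCases <;> simp [kvec]

/-- The bordered matrix in block form; later steps check solutions against it, so no block inverse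
is needed. -/
lemma IsCovarianceFunction.mulVec_append (hk : IsCovarianceFunction k p) (X : Fin n → Cube d)
    (xt : Cube d) (v : Fin n → ℝ) (c : ℝ) :
    (gram k (append X xt) + σ ^ 2 • (1 : Matrix (Fin (n + 1)) (Fin (n + 1)) ℝ)) *ᵥ append v c =
      append ((gram k X + σ ^ 2 • (1 : Matrix (Fin n) (Fin n) ℝ)) *ᵥ v + c • kvec k X xt)
        (kvec k X xt ⬝ᵥ v + (k xt xt + σ ^ 2) * c) := by
  simp only [add_mulVec, smul_mulVec, one_mulVec]
  ext i
  cases i using Fin.lastCases with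
  | last => simp [mulVec, dotProduct, gram, kvec, Fin.sum_univ_castSucc]; ring
  | cast i =>
    simp [mulVec, dotProduct, gram, kvec, Fin.sum_univ_castSucc, hk.symm xt (X i)]; ring

lemma IsCovarianceFunction.postCov_self_add_pos (hk : IsCovarianceFunction k p) (hσ : 0 < σ)
    (X : Fin n → Cube d) (xt : Cube d) : 0 < postCov k σ X xt xt + σ ^ 2 := by
  -- This vector annihilates the first n rows, so the bordered quadratic form at it is the Schur
  -- complement k_n(x̃, x̃) + σ².
  have hv : append (-(precision k σ X *ᵥ kvec k X xt)) 1 ≠ 0 := fun h => by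
    simpa using congrFun h (Fin.last n)
  have h := (hk.posDef hσ (append X xt)).dotProduct_mulVec_pos hv
  rw [hk.mulVec_append, mulVec_neg, hk.mulVec_precision hσ, star_trivial,
    append_dotProduct_append] at h
  simp only [one_smul, neg_add_cancel, dotProduct_zero, dotProduct_neg] at h
  rw [postCov]
  linarith

lemma IsCovarianceFunction.alpha_append (hk : IsCovarianceFunction k p) (hσ : 0 < σ)
    (X : Fin n → Cube d) (xt : Cube d) (y : Fin n → ℝ) (yt : ℝ) :
    alpha k σ (append X xt) (append y yt) =
      append (alpha k σ X y - ((yt - postMean k σ X y xt) / (postCov k σ X xt xt + σ ^ 2)) •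
        (precision k σ X *ᵥ kvec k X xt))
        ((yt - postMean k σ X y xt) / (postCov k σ X xt xt + σ ^ 2)) := by
  refine hk.precision_mulVec_eq hσ _ ?_
  have h := (hk.postCov_self_add_pos hσ X xt).ne'
  rw [hk.mulVec_append, mulVec_sub, mulVec_smul, hk.mulVec_precision hσ, alpha,
    hk.mulVec_precision hσ, sub_add_cancel]
  congr 1
  set c := (yt - postMean k σ X y xt) / (postCov k σ X xt xt + σ ^ 2) with hc
  rw [eq_div_iff h] at hc
  rw [postMean, alpha] at hc
  nth_rewrite 1 [postCov] at hc
  rw [dotProduct_sub, dotProduct_smul, smul_eq_mul]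
  linarith

lemma IsCovarianceFunction.postMean_append (hk : IsCovarianceFunction k p) (hσ : 0 < σ)
    (X : Fin n → Cube d) (xt : Cube d) (y : Fin n → ℝ) (yt : ℝ) (x : Cube d) :
    postMean k σ (append X xt) (append y yt) x = postMean k σ X y x +
      postCov k σ X x xt * ((yt - postMean k σ X y xt) / (postCov k σ X xt xt + σ ^ 2)) := by
  rw [postMean, hk.alpha_append hσ, kvec_append, append_dotProduct_append, dotProduct_sub,
    dotProduct_smul, smul_eq_mul]
  generalize (yt - postMean k σ X y xt) / (postCov k σ X xt xt + σ ^ 2) = c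
  rw [postMean, postCov]
  ring

lemma IsCovarianceFunction.postCov_append (hk : IsCovarianceFunction k p) (hσ : 0 < σ)
    (X : Fin n → Cube d) (xt : Cube d) (x x' : Cube d) :
    postCov k σ (append X xt) x x' = postCov k σ X x x' -
      postCov k σ X x xt * postCov k σ X xt x' / (postCov k σ X xt xt + σ ^ 2) := by
  -- The subtracted term of k_n(x, x') is a posterior mean at x, for the artificial data k(x', x_i).
  -- The covariance update is thus the mean update for these data.
  have h := hk.postMean_append hσ X xt (kvec k X x') (k x' xt) x
  have h1 : ∀ z, k x' z - postMean k σ X (kvec k X x') z = postCov k σ X z x' := fun z => by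
    rw [hk.symm x' z]; rfl
  rw [← kvec_append, h1] at h
  have h2 : postCov k σ (append X xt) x x' = k x x' -
      postMean k σ (append X xt) (kvec k (append X xt) x') x := rfl
  have h3 : postCov k σ X x x' = k x x' - postMean k σ X (kvec k X x') x := rfl
  rw [h2, h, h3]
  ring

lemma mu1_append (hk : IsCovarianceFunction k p) (hp : IsDensity p) (hσ : 0 < σ)
    (X : Fin n → Cube d) (xt : Cube d) (y : Fin n → ℝ) (yt : ℝ) :
    mu1 k p σ (append X xt) (append y yt) = mu2 k p σ X y xt yt := by
  have := hp.isProbabilityMeasure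
  simp_rw [← integral_postMean hk hp, hk.postMean_append hσ]
  rw [integral_add ((memLp_two_postMean hk hp X y).integrable one_le_two)
    ((integrable_postCov_left hk hp X xt).mul_const _), integral_mul_const,
    integral_postCov_left hk hp, integral_postMean hk hp, mu2]
  ring

/-- As σ₁² is the integral of ν, it suffices to update ν pointwise, by integrating the covariance
update in one variable. -/
lemma sigma1Sq_append (hk : IsCovarianceFunction k p) (hp : IsDensity p) (hσ : 0 < σ)
    (X : Fin n → Cube d) (xt : Cube d) :
    sigma1Sq k p σ (append X xt) = sigma2Sq k p σ X xt := by
  rw [← integral_nu hk hp hσ]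
  have h1 : ∀ x, nu k p σ (append X xt) x = nu k p σ X x -
      postCov k σ X x xt * (nu k p σ X xt / (postCov k σ X xt xt + σ ^ 2)) := fun x => by
    rw [← integral_postCov_left hk hp (append X xt) x]
    simp_rw [hk.postCov_append hσ, mul_div_assoc]
    simp_rw [mul_comm (postCov k σ X _ xt)]
    rw [integral_sub (integrable_postCov_left hk hp X x)
      ((integrable_postCov_left hk hp X xt).const_mul _), integral_const_mul,
      integral_postCov_left hk hp, integral_postCov_left hk hp, hk.postCov_comm hσ X xt x]
    ring
  simp_rw [h1]
  rw [integral_sub (integrable_nu hk hp hσ X) ((integrable_postCov_left hk hp X xt).mul_const _),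
    integral_mul_const, integral_postCov_left hk hp, integral_nu hk hp hσ, sigma2Sq]
  ring

end Append

end Covariance

end GPQoI

/-! ### The law of Q for a Gaussian process -/

namespace GPQoI

section QuantityOfInterest

variable {d n : ℕ} {k : Cube d → Cube d → ℝ} {p : Cube d → ℝ} {σ : ℝ}
  {Ω : Type*} [MeasurableSpace Ω] {P : Measure Ω} [IsProbabilityMeasure P]
  {f : Cube d → Ω → ℝ} {m : Cube d → ℝ} {κ : Cube d → Cube d → ℝ}

lemma IsDensity.qoi_eq (hp : IsDensity p) (g : Cube d → ℝ) :
    qoi p g = ∫ x, g x ∂densityMeasure p := (hp.integral_densityMeasure g).symm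

omit [IsProbabilityMeasure P] in
lemma IsGP.memLp_two (hf : IsGP f P m κ) (x : Cube d) : MemLp (f x) 2 P :=
  (hf.isGaussianProcess.hasGaussianLaw_eval x).memLp_two

lemma IsGP.integral_sq (hf : IsGP f P m κ) (x : Cube d) :
    ∫ ω, f x ω ^ 2 ∂P = κ x x + m x ^ 2 := by
  have h := covariance_eq_sub (hf.memLp_two x) (hf.memLp_two x)
  rw [hf.covariance, hf.mean] at h
  simp only [Pi.mul_apply, ← pow_two] at h
  linarith

lemma IsGP.memLp_two_uncurry (hf : IsGP f P m κ) (hp : IsDensity p)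
    (hm : MemLp m 2 (densityMeasure p)) (hκ : Integrable (fun x => κ x x) (densityMeasure p)) :
    MemLp (Function.uncurry f) 2 ((densityMeasure p).prod P) := by
  have := hp.isProbabilityMeasure
  refine _root_.memLp_two_uncurry hf.measurable hf.memLp_two ?_
  simp_rw [hf.integral_sq]
  exact hκ.add hm.integrable_sq

lemma IsGP.ae_integrable (hf : IsGP f P m κ) (hp : IsDensity p)
    (hm : MemLp m 2 (densityMeasure p)) (hκ : Integrable (fun x => κ x x) (densityMeasure p)) :
    ∀ᵐ ω ∂P, Integrable fun x => f x ω * p x := by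
  have := hp.isProbabilityMeasure
  filter_upwards [((hf.memLp_two_uncurry hp hm hκ).integrable one_le_two).prod_left_ae] with ω hω
  exact (hp.integrable_densityMeasure_iff _).1 hω

lemma IsGP.integral_qoi (hf : IsGP f P m κ) (hp : IsDensity p)
    (hm : MemLp m 2 (densityMeasure p)) (hκ : Integrable (fun x => κ x x) (densityMeasure p)) :
    ∫ ω, qoi p (fun x => f x ω) ∂P = ∫ x, m x ∂densityMeasure p := by
  have := hp.isProbabilityMeasure
  simp_rw [hp.qoi_eq]
  rw [← integral_integral_swap ((hf.memLp_two_uncurry hp hm hκ).integrable one_le_two)]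
  simp_rw [hf.mean]

lemma IsGP.memLp_two_qoi (hf : IsGP f P m κ) (hp : IsDensity p)
    (hm : MemLp m 2 (densityMeasure p)) (hκ : Integrable (fun x => κ x x) (densityMeasure p)) :
    MemLp (fun ω => qoi p fun x => f x ω) 2 P := by
  have := hp.isProbabilityMeasure
  simp_rw [hp.qoi_eq]
  exact memLp_two_integral_left (hf.memLp_two_uncurry hp hm hκ)

lemma IsGP.covariance_qoi_left (hf : IsGP f P m κ) (hp : IsDensity p)
    (hm : MemLp m 2 (densityMeasure p)) (hκ : Integrable (fun x => κ x x) (densityMeasure p))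
    {g : Ω → ℝ} (hg : MemLp g 2 P) :
    cov[fun ω => qoi p fun x => f x ω, g; P] = ∫ x, cov[f x, g; P] ∂densityMeasure p := by
  have := hp.isProbabilityMeasure
  simp_rw [hp.qoi_eq]
  exact covariance_integral_left (hf.memLp_two_uncurry hp hm hκ) hf.memLp_two hg

lemma IsGP.variance_qoi (hf : IsGP f P m κ) (hp : IsDensity p)
    (hm : MemLp m 2 (densityMeasure p)) (hκ : Integrable (fun x => κ x x) (densityMeasure p)) :
    Var[fun ω => qoi p fun x => f x ω; P] =
      ∫ x, ∫ x', κ x x' ∂densityMeasure p ∂densityMeasure p := by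
  have hQ := hf.memLp_two_qoi hp hm hκ
  rw [← covariance_self hQ.1.aemeasurable, hf.covariance_qoi_left hp hm hκ hQ]
  congr 1 with x
  rw [covariance_comm, hf.covariance_qoi_left hp hm hκ (hf.memLp_two x)]
  congr 1 with x'
  rw [covariance_comm, hf.covariance]

lemma IsGP.integral_mul_qoi_eq_zero (hf : IsGP f P m κ) (hp : IsDensity p)
    (hm : MemLp m 2 (densityMeasure p)) (hκ : Integrable (fun x => κ x x) (densityMeasure p))
    {g : Ω → ℝ} (hg : MemLp g 2 P) (h : ∀ x, ∫ ω, g ω * f x ω ∂P = 0) :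
    ∫ ω, g ω * qoi p (fun x => f x ω) ∂P = 0 := by
  have := hp.isProbabilityMeasure
  simp_rw [hp.qoi_eq]
  rw [integral_mul_integral_left (hf.memLp_two_uncurry hp hm hκ) hg]
  simp [h]

lemma IsGP.isNormal_qoi (hf : IsGP f P m κ) (hp : IsDensity p)
    (hm : MemLp m 2 (densityMeasure p)) (hκ : Integrable (fun x => κ x x) (densityMeasure p)) :
    IsNormal (P.map fun ω => qoi p fun x => f x ω) (∫ x, m x ∂densityMeasure p)
      (∫ x, ∫ x', κ x x' ∂densityMeasure p ∂densityMeasure p) := by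
  have hG : HasGaussianLaw (fun ω => qoi p fun x => f x ω) P :=
    hf.isGaussianProcess.hasGaussianLaw_of_orthogonal (hf.memLp_two_qoi hp hm hκ)
      fun g hg h => hf.integral_mul_qoi_eq_zero hp hm hκ hg h
  rw [← hf.variance_qoi hp hm hκ, ← hf.integral_qoi hp hm hκ]
  exact ⟨variance_nonneg _ _, hG.map_eq_gaussianReal⟩

/-- The quantity of interest under the posterior process. -/
lemma ae_integrable_and_isNormal_of_posterior (hp : IsDensity p) (hk : IsCovarianceFunction k p)
    (hσ : 0 < σ) (X : Fin n → Cube d) (y : Fin n → ℝ) {g : Cube d → Ω → ℝ}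
    (hg : IsGP g P (postMean k σ X y) (postCov k σ X)) :
    (∀ᵐ ω ∂P, Integrable fun x => g x ω * p x) ∧
      IsNormal (P.map fun ω => qoi p fun x => g x ω) (mu1 k p σ X y) (sigma1Sq k p σ X) := by
  have hm := memLp_two_postMean (σ := σ) hk hp X y
  have hκ := integrable_postCov_diag (σ := σ) hk hp X
  refine ⟨hg.ae_integrable hp hm hκ, ?_⟩
  have h := hg.isNormal_qoi hp hm hκ
  rwa [integral_integral_postCov hk hp hσ, integral_postMean hk hp] at h

end QuantityOfInterest

/-! ### Conditioning Q on noisy observations -/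

section NoisyObservation

variable {d n : ℕ} {k : Cube d → Cube d → ℝ} {p : Cube d → ℝ} {σ : ℝ}
  {Ω : Type*} [MeasurableSpace Ω] {P : Measure Ω} [IsProbabilityMeasure P]
  {f : Cube d → Ω → ℝ} {X : Fin n → Cube d} {Y : Fin n → Ω → ℝ}

omit [IsProbabilityMeasure P] in
lemma IsNoisyObservation.hasGaussianLaw_noise (h : IsNoisyObservation f P σ X Y) (i : Fin n) :
    HasGaussianLaw (fun ω => Y i ω - f (X i) ω) P :=
  (h.noise_law i).hasGaussianLaw

omit [IsProbabilityMeasure P] in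
lemma IsNoisyObservation.integral_noise (h : IsNoisyObservation f P σ X Y) (i : Fin n) :
    ∫ ω, (Y i ω - f (X i) ω) ∂P = 0 := by
  rw [(h.noise_law i).integral_eq, integral_id_gaussianReal]

omit [IsProbabilityMeasure P] in
lemma IsNoisyObservation.covariance_noise (h : IsNoisyObservation f P σ X Y) (i j : Fin n) :
    cov[fun ω => Y i ω - f (X i) ω, fun ω => Y j ω - f (X j) ω; P] =
      (σ ^ 2 • (1 : Matrix (Fin n) (Fin n) ℝ)) i j := by
  rcases eq_or_ne i j with rfl | hij
  · rw [covariance_self (h.hasGaussianLaw_noise i).aemeasurable, (h.noise_law i).variance_eq,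
      variance_id_gaussianReal]
    simp [sq_nonneg]
  · rw [(h.noise_indep.indepFun hij).covariance_eq_zero (h.hasGaussianLaw_noise i).memLp_two
      (h.hasGaussianLaw_noise j).memLp_two]
    simp [hij]

variable {m : Cube d → ℝ} {κ : Cube d → Cube d → ℝ}

omit [IsProbabilityMeasure P] in
lemma IsNoisyObservation.covariance_process_noise (h : IsNoisyObservation f P σ X Y)
    (hf : IsGP f P m κ) (x : Cube d) (i : Fin n) :
    cov[f x, fun ω => Y i ω - f (X i) ω; P] = 0 :=
  IndepFun.covariance_eq_zero
    (h.noise_indep_process.symm.comp (measurable_pi_apply x) (measurable_pi_apply i))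
    (hf.memLp_two x) (h.hasGaussianLaw_noise i).memLp_two

omit [MeasurableSpace Ω] in
lemma IsNoisyObservation.eq_add (i : Fin n) :
    Y i = f (X i) + fun ω => Y i ω - f (X i) ω := by ext; simp

omit [IsProbabilityMeasure P] in
lemma IsNoisyObservation.memLp_two (h : IsNoisyObservation f P σ X Y) (hf : IsGP f P m κ)
    (i : Fin n) : MemLp (Y i) 2 P := by
  rw [eq_add (f := f) (X := X) (Y := Y) i]
  exact (hf.memLp_two _).add (h.hasGaussianLaw_noise i).memLp_two

lemma IsNoisyObservation.covariance_process (h : IsNoisyObservation f P σ X Y)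
    (hf : IsGP f P m κ) (x : Cube d) (j : Fin n) : cov[f x, Y j; P] = κ x (X j) := by
  rw [eq_add (f := f) (X := X) (Y := Y) j, covariance_add_right (hf.memLp_two _) (hf.memLp_two _)
    (h.hasGaussianLaw_noise j).memLp_two, hf.covariance, h.covariance_process_noise hf, add_zero]

lemma IsNoisyObservation.covariance_observation (h : IsNoisyObservation f P σ X Y)
    (hf : IsGP f P m κ) (i j : Fin n) :
    cov[Y i, Y j; P] = (gram κ X + σ ^ 2 • (1 : Matrix (Fin n) (Fin n) ℝ)) i j := by
  have hE := fun i => (h.hasGaussianLaw_noise i).memLp_two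
  rw [eq_add (f := f) (X := X) (Y := Y) i, covariance_add_left (hf.memLp_two _) (hE i)
    (h.memLp_two hf j), h.covariance_process hf]
  have h1 : cov[fun ω => Y i ω - f (X i) ω, Y j; P] =
      (σ ^ 2 • (1 : Matrix (Fin n) (Fin n) ℝ)) i j := by
    conv_lhs => rw [covariance_comm, eq_add (f := f) (X := X) (Y := Y) j]
    rw [covariance_add_left (hf.memLp_two _) (hE j) (hE i), h.covariance_process_noise hf,
      covariance_comm, h.covariance_noise, zero_add]
  rw [h1]
  rfl

lemma IsNoisyObservation.integral_observation (h : IsNoisyObservation f P σ X Y)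
    (hf : IsGP f P (fun _ => 0) κ) (i : Fin n) : ∫ ω, Y i ω ∂P = 0 := by
  have h1 := integral_sub ((h.memLp_two hf i).integrable one_le_two)
    ((hf.memLp_two (X i)).integrable one_le_two)
  rw [h.integral_noise, hf.mean] at h1
  linarith

omit [IsProbabilityMeasure P] in
lemma IsNoisyObservation.isGaussianProcess_sumElim (h : IsNoisyObservation f P σ X Y)
    (hf : IsGP f P m κ) :
    IsGaussianProcess (Sum.elim f fun i ω => Y i ω - f (X i) ω) P :=
  hf.isGaussianProcess.sumElim_of_indepFun
    (h.noise_indep.hasGaussianLaw h.hasGaussianLaw_noise) h.noise_indep_process.symm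

/-- Given the observations, the quantity of interest is the posterior mean plus an independent
centred normal variable. -/
lemma IsNoisyObservation.exists_residual (h : IsNoisyObservation f P σ X Y) (hp : IsDensity p)
    (hk : IsCovarianceFunction k p) (hσ : 0 < σ) (hf : IsGP f P (fun _ => 0) k) :
    ∃ R : Ω → ℝ, 0 ≤ sigma1Sq k p σ X ∧ HasLaw R (gaussianReal 0 (sigma1Sq k p σ X).toNNReal) P ∧
      IndepFun R (fun ω i => Y i ω) P ∧
      ∀ ω, qoi p (fun x => f x ω) = R ω + mu1 k p σ X fun i => Y i ω := by
  have hm : MemLp (fun _ : Cube d => (0 : ℝ)) 2 (densityMeasure p) := MemLp.zero'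
  have hκ := hk.integrable_diag_densityMeasure hp
  have hY := h.memLp_two hf
  set Q : Ω → ℝ := fun ω => qoi p fun x => f x ω with hQ_def
  have hQ : MemLp Q 2 P := hf.memLp_two_qoi hp hm hκ
  -- Regression coefficients of Q on Y: c solves Cov(Y) c = Cov(Q, Y), which is what makes R
  -- uncorrelated with Y.
  set c : Fin n → ℝ := precision k σ X *ᵥ epsVec k p X with hc
  have hcov : ∀ j, cov[Q, Y j; P] = epsVec k p X j := fun j => by
    rw [hf.covariance_qoi_left hp hm hκ (hY j)]
    simp_rw [h.covariance_process hf]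
    exact (hk.eps_eq_left hp _).symm
  have hS : MemLp (fun ω => ∑ i, c i * Y i ω) 2 P :=
    memLp_finsetSum _ fun i _ => (hY i).const_mul _
  set R : Ω → ℝ := fun ω => Q ω - ∑ i, c i * Y i ω with hR_def
  have hR : MemLp R 2 P := hQ.sub hS
  have hRY : ∀ j, cov[R, Y j; P] = 0 := fun j => by
    rw [hR_def, covariance_fun_sub_left hQ hS (hY j), hcov,
      covariance_fun_sum_left (fun i => (hY i).const_mul _) (hY j), sub_eq_zero]
    conv_lhs => rw [← hk.mulVec_precision hσ X (epsVec k p X), ← hc]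
    simp only [mulVec, dotProduct]
    refine Finset.sum_congr rfl fun i _ => ?_
    rw [covariance_const_mul_left, covariance_comm, h.covariance_observation hf, mul_comm]
  have hRG : HasGaussianLaw (fun ω => (R ω, fun i => Y i ω)) P := by
    refine hasGaussianLaw_prodMk_of_forall hR.1.aemeasurable (fun i => (hY i).1.aemeasurable)
      fun a b => ?_
    have hZ : MemLp (fun ω => a * R ω + ∑ i, b i * Y i ω) 2 P :=
      (hR.const_mul a).add (memLp_finsetSum _ fun i _ => (hY i).const_mul _)
    -- If g is orthogonal to f and to the noise, it is orthogonal to Y and to Q, hence to every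
    -- combination of R and Y.
    refine (h.isGaussianProcess_sumElim hf).hasGaussianLaw_of_orthogonal hZ fun g hg ho => ?_
    have hgY : ∀ i, Integrable (fun ω => g ω * Y i ω) P := fun i => hg.integrable_mul (hY i)
    have hgf : ∀ x, Integrable (fun ω => g ω * f x ω) P :=
      fun x => hg.integrable_mul (hf.memLp_two x)
    have hgQ : Integrable (fun ω => g ω * Q ω) P := hg.integrable_mul hQ
    have ho1 : ∀ x, ∫ ω, g ω * f x ω ∂P = 0 := fun x => ho (Sum.inl x)
    have ho2 : ∀ i, ∫ ω, g ω * Y i ω ∂P = 0 := fun i => by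
      have h1 := ho (Sum.inr i)
      simp only [Sum.elim_inr, mul_sub] at h1
      rw [integral_sub (hgY i) (hgf _), ho1] at h1
      linarith
    have ho3 : ∫ ω, g ω * Q ω ∂P = 0 := hf.integral_mul_qoi_eq_zero hp hm hκ hg ho1
    have h2 : ∀ ω, g ω * (a * R ω + ∑ i, b i * Y i ω) =
        a * (g ω * Q ω) + ∑ i, (b i - a * c i) * (g ω * Y i ω) := fun ω => by
      simp only [hR_def, mul_add, mul_sub, sub_mul, Finset.mul_sum, Finset.sum_sub_distrib]
      ring_nf
    simp_rw [h2]
    rw [integral_add (hgQ.const_mul _)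
      (integrable_finsetSum _ fun i _ => (hgY i).const_mul _),
      integral_const_mul, ho3,
      integral_finsetSum _ fun i _ => (hgY i).const_mul _]
    simp_rw [integral_const_mul, ho2]
    simp
  have hind : IndepFun R (fun ω i => Y i ω) P := by
    -- R is viewed as a family indexed by `Unit`, the form in which uncorrelated jointly Gaussian
    -- families are known to be independent.
    have h1 := hRG.map_fun (ContinuousLinearMap.prodMap
      (ContinuousLinearMap.pi fun _ : Unit => .id ℝ ℝ) (.id ℝ (Fin n → ℝ)))
    have h2 := HasGaussianLaw.indepFun_of_covariance_eval (X := fun _ : Unit => R) (Y := Y) h1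
      fun _ j => hRY j
    exact h2.comp (measurable_pi_apply ()) measurable_id
  have hvar : Var[R; P] = sigma1Sq k p σ X := by
    have h1 : cov[R, fun ω => ∑ i, c i * Y i ω; P] = 0 := by
      rw [covariance_fun_sum_right (fun i => (hY i).const_mul _) hR]
      simp [covariance_const_mul_right, hRY]
    -- R is uncorrelated with cᵀY, so only its covariance with Q contributes to its variance.
    have h2 : cov[R, R; P] = cov[R, Q; P] := by
      conv_lhs => rw [hR_def]
      rw [covariance_fun_sub_right hR hQ hS, h1, sub_zero]
    rw [← covariance_self hR.1.aemeasurable, h2, hR_def, covariance_fun_sub_left hQ hS hQ,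
      covariance_self hQ.1.aemeasurable, hf.variance_qoi hp hm hκ,
      covariance_fun_sum_left (fun i => (hY i).const_mul _) hQ, sigma1Sq, sigma0Sq_eq hp]
    simp_rw [eps_eq hp, covariance_const_mul_left, covariance_comm (Y _) Q, hcov]
    rw [dotProduct_comm]
    rfl
  have hmean : ∫ ω, R ω ∂P = 0 := by
    rw [hR_def, integral_sub (hQ.integrable one_le_two) (hS.integrable one_le_two),
      integral_finsetSum _ fun i _ => ((hY i).const_mul _).integrable one_le_two,
      hf.integral_qoi hp hm hκ]
    simp [integral_const_mul, h.integral_observation hf]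
  refine ⟨R, hvar ▸ variance_nonneg _ _, ⟨hR.1.aemeasurable, ?_⟩, hind, fun ω => ?_⟩
  · rw [hRG.fst.map_eq_gaussianReal, hvar, hmean]
  · rw [mu1, alpha, hk.dotProduct_precision_comm hσ, dotProduct_comm, ← hc]
    simp [hR_def, hQ_def, dotProduct]

/-- The encoding φ with left inverse ψ serves both the plain data vector (identity) and the pair (y,
ỹ) obtained by splitting off the last of n + 1 observations. -/
lemma IsNoisyObservation.condDistrib_qoi {β : Type*} [MeasurableSpace β]
    (h : IsNoisyObservation f P σ X Y) (hp : IsDensity p) (hk : IsCovarianceFunction k p)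
    (hσ : 0 < σ) (hf : IsGP f P (fun _ => 0) k) {φ : (Fin n → ℝ) → β} {ψ : β → Fin n → ℝ}
    (hφ : Measurable φ) (hψ : Measurable ψ) (hψφ : ∀ y, ψ (φ y) = y) :
    ∀ᵐ z ∂(P.map fun ω => φ fun i => Y i ω),
      IsNormal (condDistrib (fun ω => qoi p fun x => f x ω) (fun ω => φ fun i => Y i ω) P z)
        (mu1 k p σ X (ψ z)) (sigma1Sq k p σ X) := by
  obtain ⟨R, hv, hR, hind, hQ⟩ := h.exists_residual hp hk hσ hf
  have hYm : AEMeasurable (fun ω i => Y i ω) P :=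
    aemeasurable_pi_lambda _ fun i => (h.memLp_two hf i).1.aemeasurable
  have hc : Measurable fun z => mu1 k p σ X (ψ z) := by
    have : Measurable fun y => mu1 k p σ X y := by
      unfold mu1 alpha
      exact (Continuous.dotProduct continuous_const
        (Continuous.matrix_mulVec continuous_const continuous_id)).measurable
    exact this.comp hψ
  filter_upwards [condDistrib_add_of_indepFun hR (hφ.comp_aemeasurable hYm) hc
    (hind.comp measurable_id hφ) (Q := fun ω => qoi p fun x => f x ω)
    (ae_of_all _ fun ω => by simpa [hψφ] using hQ ω)] with z hz
  exact ⟨hv, hz⟩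

end NoisyObservation

end GPQoI

namespace GPQoI

/-! ### The error function and one-dimensional integrals -/

section ErrorFunction

lemma hasDerivAt_erf (z : ℝ) : HasDerivAt erf (2 / √Real.pi * Real.exp (-z ^ 2)) z := by
  have hc : Continuous fun t : ℝ => Real.exp (-t ^ 2) := by fun_prop
  exact (hc.integral_hasStrictDerivAt 0 z).hasDerivAt.const_mul _

lemma continuous_erf : Continuous erf :=
  continuous_iff_continuousAt.2 fun z => (hasDerivAt_erf z).continuousAt

lemma erf_zero : erf 0 = 0 := by simp [erf]

lemma erf_neg (z : ℝ) : erf (-z) = -erf z := by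
  have h := intervalIntegral.integral_comp_neg (a := 0) (b := z) fun t => Real.exp (-t ^ 2)
  simp only [neg_sq, neg_zero] at h
  rw [erf, erf, h, intervalIntegral.integral_symm]
  ring

lemma hasDerivAt_erf_primitive (z : ℝ) :
    HasDerivAt (fun u => u * erf u + Real.exp (-u ^ 2) / √Real.pi) (erf z) z := by
  have h := ((hasDerivAt_id z).mul (hasDerivAt_erf z)).add
    (((hasDerivAt_pow 2 z).neg.exp).div_const √Real.pi)
  convert! h using 1
  simp
  ring

lemma integral_exp_neg_sq_div {l : ℝ} (hl : 0 < l) (x : ℝ) :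
    ∫ t in (0 : ℝ)..1, Real.exp (-(1 / 2) * ((x - t) ^ 2 / l ^ 2)) =
      √(Real.pi / 2) * (l * (erf ((1 - x) / (√2 * l)) - erf (-x / (√2 * l)))) := by
  have h2 : √2 ≠ 0 := by positivity
  have hp : √Real.pi ≠ 0 := by positivity
  have hd : ∀ t : ℝ, HasDerivAt (fun t => √(Real.pi / 2) * (l * erf ((t - x) / (√2 * l))))
      (Real.exp (-(1 / 2) * ((x - t) ^ 2 / l ^ 2))) t := fun t => by
    have h := (((hasDerivAt_erf ((t - x) / (√2 * l))).comp t
      (((hasDerivAt_id t).sub_const x).div_const (√2 * l))).const_mul l).const_mul √(Real.pi / 2)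
    convert! h using 1
    have h3 : -((t - x) / (√2 * l)) ^ 2 = -(1 / 2) * ((x - t) ^ 2 / l ^ 2) := by
      rw [div_pow, mul_pow, Real.sq_sqrt zero_le_two]
      field_simp
      ring
    rw [h3, Real.sqrt_div Real.pi_pos.le]
    field_simp
    rw [Real.sq_sqrt zero_le_two]
  rw [intervalIntegral.integral_eq_sub_of_hasDerivAt (fun t _ => hd t)
    (by apply Continuous.intervalIntegrable; fun_prop)]
  rw [zero_sub]
  ring

lemma integral_erf_sub_erf {l : ℝ} (hl : 0 < l) :
    ∫ x in (0 : ℝ)..1, √(Real.pi / 2) * (l * (erf ((1 - x) / (√2 * l)) - erf (-x / (√2 * l)))) =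
      2 * l ^ 2 * √Real.pi * (-1 / √Real.pi + 1 / √Real.pi * Real.exp (-1 / (2 * l ^ 2)) +
        1 / (√2 * l) * erf (1 / (√2 * l))) := by
  have h2 : √2 ≠ 0 := by positivity
  have hp : √Real.pi ≠ 0 := by positivity
  -- A primitive of erf. Below, the factor √2 l compensates the inner derivative −1/(√2 l), whose
  -- sign explains the order of the difference.
  set G : ℝ → ℝ := fun u => u * erf u + Real.exp (-u ^ 2) / √Real.pi with hG
  have hd : ∀ x : ℝ, HasDerivAt
      (fun x => √(Real.pi / 2) * (l * (√2 * l * (G (-x / (√2 * l)) - G ((1 - x) / (√2 * l))))))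
      (√(Real.pi / 2) * (l * (erf ((1 - x) / (√2 * l)) - erf (-x / (√2 * l))))) x := fun x => by
    have ha := (hasDerivAt_erf_primitive (-x / (√2 * l))).comp x
      ((hasDerivAt_id x).neg.div_const (√2 * l))
    have hb := (hasDerivAt_erf_primitive ((1 - x) / (√2 * l))).comp x
      (((hasDerivAt_id x).const_sub 1).div_const (√2 * l))
    have h := (((ha.sub hb).const_mul (√2 * l)).const_mul l).const_mul √(Real.pi / 2)
    convert! h using 1
    field_simp
    ring
  have he : Continuous fun x : ℝ => √(Real.pi / 2) * (l * (erf ((1 - x) / (√2 * l)) - erf (-x / (√2 * l)))) := by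
    have := continuous_erf
    fun_prop
  rw [intervalIntegral.integral_eq_sub_of_hasDerivAt (fun t _ => hd t) (he.intervalIntegrable _ _)]
  have h3 : (1 / (√2 * l)) ^ 2 = 1 / (2 * l ^ 2) := by
    rw [div_pow, mul_pow, Real.sq_sqrt zero_le_two, one_pow]
  simp only [hG, neg_div, erf_neg, neg_sq, sub_self, sub_zero, neg_zero, zero_div, erf_zero, h3]
  rw [Real.sqrt_div Real.pi_pos.le]
  field_simp
  simp
  ring

lemma integral_unitInterval (g : ℝ → ℝ) :
    ∫ t : unitInterval, g t = ∫ t in (0 : ℝ)..1, g t := by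
  rw [intervalIntegral.integral_of_le zero_le_one, ← integral_Icc_eq_integral_Ioc,
    ← unitInterval.measurePreserving_coe.integral_comp
      (MeasurableEmbedding.subtype_coe measurableSet_Icc)]

end ErrorFunction

/-! ### The squared-exponential kernel -/

section SquaredExponential

variable {d : ℕ}

/-- The easy half of Bochner's theorem: the kernel is the characteristic function of N(0, 1/l²) at
u_a − u_b, so its quadratic form is the integral of |∑ c_a exp(i u_a t)|². For l = 0 the measure is
a Dirac mass and, with division by zero equal to 0, the kernel is constantly 1. -/
lemma posSemidef_exp_neg_sq_div {m : ℕ} (l : ℝ) (u : Fin m → ℝ) :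
    (Matrix.of fun a b => Real.exp (-(1 / 2) * ((u a - u b) ^ 2 / l ^ 2))).PosSemidef := by
  set γ : Measure ℝ := gaussianReal 0 (l ^ 2)⁻¹.toNNReal with hγ
  have hcos : ∀ w, Integrable (fun t => Real.cos (w * t)) γ := fun w =>
    Integrable.of_bound (C := 1) (by fun_prop) (ae_of_all _ fun t => Real.abs_cos_le_one _)
  have hint : ∀ w, ∫ t, Real.cos (w * t) ∂γ = Real.exp (-(1 / 2) * (w ^ 2 / l ^ 2)) := fun w => by
    have h := congrArg Complex.re (charFun_gaussianReal (μ := 0) (v := (l ^ 2)⁻¹.toNNReal) w)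
    rw [charFun_apply_real, ← hγ] at h
    have hI : Integrable (fun t : ℝ => Complex.exp (w * t * Complex.I)) γ := by
      refine Integrable.of_bound (C := 1) (by fun_prop) (ae_of_all _ fun t => ?_)
      rw [← Complex.ofReal_mul, Complex.norm_exp_ofReal_mul_I]
    rw [← RCLike.re_eq_complex_re, ← integral_re hI] at h
    simp only [RCLike.re_eq_complex_re, ← Complex.ofReal_mul, Complex.exp_ofReal_mul_I_re] at h
    rw [h]
    have h4 : (((w * 0 : ℝ) : ℂ) * Complex.I - ((l ^ 2)⁻¹.toNNReal : ℝ) * w ^ 2 / 2 : ℂ) =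
        ((-(1 / 2) * (w ^ 2 / l ^ 2) : ℝ) : ℂ) := by
      rw [Real.coe_toNNReal _ (by positivity)]
      push_cast
      ring
    rw [h4, Complex.exp_ofReal_re]
  refine PosSemidef.of_dotProduct_mulVec_nonneg ?_ fun c => ?_
  · ext a b
    simp only [conjTranspose_apply, of_apply, star_trivial]
    rw [← neg_sub, neg_sq]
  · have h : star c ⬝ᵥ (Matrix.of (fun a b =>
        Real.exp (-(1 / 2) * ((u a - u b) ^ 2 / l ^ 2))) *ᵥ c) =
        ∫ t, ((∑ a, c a * Real.cos (u a * t)) ^ 2 + (∑ a, c a * Real.sin (u a * t)) ^ 2) ∂γ := by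
      have h1 : ∀ t, (∑ a, c a * Real.cos (u a * t)) ^ 2 + (∑ a, c a * Real.sin (u a * t)) ^ 2 =
          ∑ a, ∑ b, c a * c b * Real.cos ((u a - u b) * t) := fun t => by
        rw [pow_two, pow_two, Finset.sum_mul_sum, Finset.sum_mul_sum, ← Finset.sum_add_distrib]
        refine Finset.sum_congr rfl fun a _ => ?_
        rw [← Finset.sum_add_distrib]
        refine Finset.sum_congr rfl fun b _ => ?_
        rw [sub_mul, Real.cos_sub]
        ring
      simp_rw [h1]
      rw [integral_finsetSum _ fun a _ => integrable_finsetSum _ fun b _ => (hcos _).const_mul _]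
      simp_rw [integral_finsetSum _ fun b _ => (hcos _).const_mul _, integral_const_mul, hint]
      simp only [dotProduct, mulVec, of_apply, star_trivial, Finset.mul_sum]
      refine Finset.sum_congr rfl fun a _ => Finset.sum_congr rfl fun b _ => ?_
      ring
    rw [h]
    exact integral_nonneg fun t => by positivity

/-- Schur product theorem, one coordinate at a time, starting from the rank-one matrix with all
entries s². -/
lemma posSemidef_gram_sqExpKernel (s : ℝ) (ℓ : Fin d → ℝ) {m : ℕ} (z : Fin m → Cube d) :
    (gram (sqExpKernel s ℓ) z).PosSemidef := by
  have h : ∀ S : Finset (Fin d), (Matrix.of fun a b => s ^ 2 * Real.exp (-(1 / 2) *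
      ∑ j ∈ S, ((z a j : ℝ) - (z b j : ℝ)) ^ 2 / ℓ j ^ 2)).PosSemidef := fun S => by
    induction S using Finset.induction_on with
    | empty =>
      convert! posSemidef_vecMulVec_self_star (fun _ : Fin m => s) using 1
      ext a b
      simp [vecMulVec, pow_two]
    | insert j S hj ih =>
      convert! (posSemidef_exp_neg_sq_div (ℓ j) fun a => (z a j : ℝ)).hadamard ih using 1
      ext a b
      simp only [of_apply, hadamard_apply, Finset.sum_insert hj, mul_add, Real.exp_add]
      ring
  exact h Finset.univ

lemma sqExpKernel_eq_prod (s : ℝ) (ℓ : Fin d → ℝ) (x x' : Cube d) :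
    sqExpKernel s ℓ x x' =
      s ^ 2 * ∏ j, Real.exp (-(1 / 2) * (((x j : ℝ) - (x' j : ℝ)) ^ 2 / ℓ j ^ 2)) := by
  rw [sqExpKernel, Finset.mul_sum, Real.exp_sum]

lemma isDensity_one : IsDensity fun _ : Cube d => (1 : ℝ) where
  measurable := measurable_const
  nonneg _ := zero_le_one
  integral_eq_one := by simp

lemma isCovarianceFunction_sqExpKernel (s : ℝ) (ℓ : Fin d → ℝ) :
    IsCovarianceFunction (sqExpKernel s ℓ) fun _ => 1 where
  measurable := by
    simp only [Function.uncurry_def, sqExpKernel]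
    fun_prop
  posSemidef _ z := posSemidef_gram_sqExpKernel s ℓ z
  integrable_diag := by simp [sqExpKernel]

lemma eps_sqExpKernel_eq_prod (s : ℝ) {ℓ : Fin d → ℝ} (hℓ : ∀ j, 0 < ℓ j) (x : Cube d) :
    eps (sqExpKernel s ℓ) (fun _ => 1) x = s ^ 2 * ∏ j, (√(Real.pi / 2) *
      (ℓ j * (erf ((1 - (x j : ℝ)) / (√2 * ℓ j)) - erf (-(x j : ℝ) / (√2 * ℓ j))))) := by
  simp only [eps, mul_one, sqExpKernel_eq_prod]
  rw [integral_const_mul, integral_fintype_prod_volume_eq_prod fun j (t : unitInterval) =>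
    Real.exp (-(1 / 2) * (((x j : ℝ) - (t : ℝ)) ^ 2 / ℓ j ^ 2))]
  congr 1
  refine Finset.prod_congr rfl fun j _ => ?_
  rw [integral_unitInterval fun t => Real.exp (-(1 / 2) * (((x j : ℝ) - t) ^ 2 / ℓ j ^ 2)),
    integral_exp_neg_sq_div (hℓ j)]

lemma eps_sqExpKernel (s : ℝ) {ℓ : Fin d → ℝ} (hℓ : ∀ j, 0 < ℓ j) (x : Cube d) :
    eps (sqExpKernel s ℓ) (fun _ => 1) x =
        s ^ 2 * (Real.pi / 2) ^ ((d : ℝ) / 2) *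
          ∏ j, (ℓ j * (erf ((1 - (x j : ℝ)) / (√2 * ℓ j)) -
            erf (-(x j : ℝ) / (√2 * ℓ j)))) := by
  rw [eps_sqExpKernel_eq_prod s hℓ, Finset.prod_mul_distrib, Finset.prod_const, Finset.card_univ,
    Fintype.card_fin, Real.sqrt_eq_rpow, ← Real.rpow_natCast _ d, ← Real.rpow_mul (by positivity), mul_assoc,
    one_div_mul_eq_div]

lemma sigma0Sq_sqExpKernel (s : ℝ) {ℓ : Fin d → ℝ} (hℓ : ∀ j, 0 < ℓ j) :
    sigma0Sq (sqExpKernel s ℓ) (fun _ : Cube d => (1 : ℝ)) =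
        s ^ 2 * ∏ j, (2 * ℓ j ^ 2 * √Real.pi *
          (-1 / √Real.pi + 1 / √Real.pi * Real.exp (-1 / (2 * ℓ j ^ 2)) +
            1 / (√2 * ℓ j) * erf (1 / (√2 * ℓ j)))) := by
  rw [sigma0Sq_eq isDensity_one, isDensity_one.integral_densityMeasure]
  simp only [mul_one, eps_sqExpKernel_eq_prod s hℓ]
  rw [integral_const_mul, integral_fintype_prod_volume_eq_prod fun j (t : unitInterval) =>
    √(Real.pi / 2) * (ℓ j * (erf ((1 - (t : ℝ)) / (√2 * ℓ j)) - erf (-(t : ℝ) / (√2 * ℓ j))))]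
  congr 1
  refine Finset.prod_congr rfl fun j _ => ?_
  rw [integral_unitInterval fun t => √(Real.pi / 2) *
    (ℓ j * (erf ((1 - t) / (√2 * ℓ j)) - erf (-t / (√2 * ℓ j)))), integral_erf_sub_erf (hℓ j)]

end SquaredExponential

end GPQoI

/-! ### Assembling the theorem -/

namespace GPQoI

lemma measurable_append {n : ℕ} :
    Measurable fun z : (Fin n → ℝ) × ℝ => append z.1 z.2 := by
  refine measurable_pi_lambda _ fun i => ?_
  cases i using Fin.lastCases with
  | last => simpa using measurable_snd
  | cast i => simpa using! (measurable_pi_apply i).comp measurable_fst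

end GPQoI

theorem mainTheorem2 {d n : ℕ} (p : Cube d → ℝ) (hp : IsDensity p)
    (k : Cube d → Cube d → ℝ) (hk : IsCovarianceFunction k p) (σ : ℝ) (hσ : 0 < σ)
    (X : Fin n → Cube d) (xt : Cube d)
    {Ω : Type*} [MeasurableSpace Ω] (P : Measure Ω) [IsProbabilityMeasure P] :
    -- Current state of knowledge: mean and variance of `Q` from the posterior mean and covariance.
    ((∀ y : Fin n → ℝ, ∫ x, postMean k σ X y x * p x = mu1 k p σ X y) ∧
      ∫ x, ∫ x', postCov k σ X x x' * p x * p x' = sigma1Sq k p σ X) ∧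
    -- Prior `GP(0, k)` and noisy observations `Y` at `X`: the conditional law of `Q[f]` given `Y`.
    (∀ (f : Cube d → Ω → ℝ) (Y : Fin n → Ω → ℝ),
      IsGP f P (fun _ => 0) k → IsNoisyObservation f P σ X Y →
      (∀ᵐ ω ∂P, Integrable fun x => f x ω * p x) ∧
      ∀ᵐ y ∂(P.map fun ω i => Y i ω),
        IsNormal (condDistrib (fun ω => qoi p fun x => f x ω) (fun ω i => Y i ω) P y)
          (mu1 k p σ X y) (sigma1Sq k p σ X)) ∧
    -- For every data vector `y`: the law of `Q[g]` for `g` distributed as the posterior process.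
    (∀ (y : Fin n → ℝ) (g : Cube d → Ω → ℝ),
      IsGP g P (postMean k σ X y) (postCov k σ X) →
      (∀ᵐ ω ∂P, Integrable fun x => g x ω * p x) ∧
      IsNormal (P.map fun ω => qoi p fun x => g x ω) (mu1 k p σ X y) (sigma1Sq k p σ X)) ∧
    -- Adding a hypothetical observation `yt` at `xt`: posterior mean and covariance functions.
    ((∀ (y : Fin n → ℝ) (yt : ℝ) (x : Cube d),
        postMean k σ (append X xt) (append y yt) x = postMean k σ X y x +
          postCov k σ X x xt * ((yt - postMean k σ X y xt) / (postCov k σ X xt xt + σ ^ 2))) ∧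
      (∀ x x' : Cube d,
        postCov k σ (append X xt) x x' = postCov k σ X x x' -
          postCov k σ X x xt * postCov k σ X xt x' / (postCov k σ X xt xt + σ ^ 2)) ∧
      (∀ (y : Fin n → ℝ) (yt : ℝ),
        ∫ x, postMean k σ (append X xt) (append y yt) x * p x = mu2 k p σ X y xt yt) ∧
      ∫ x, ∫ x', postCov k σ (append X xt) x x' * p x * p x' = sigma2Sq k p σ X xt) ∧
    -- The conditional law of `Q[f]` given the data and the hypothetical observation.
    (∀ (f : Cube d → Ω → ℝ) (Y : Fin n → Ω → ℝ) (Yt : Ω → ℝ),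
      IsGP f P (fun _ => 0) k → IsNoisyObservation f P σ (append X xt) (append Y Yt) →
      ∀ᵐ z ∂(P.map fun ω => ((fun i => Y i ω : Fin n → ℝ), Yt ω)),
        IsNormal (condDistrib (fun ω => qoi p fun x => f x ω)
            (fun ω => ((fun i => Y i ω : Fin n → ℝ), Yt ω)) P z)
          (mu2 k p σ X z.1 xt z.2) (sigma2Sq k p σ X xt)) ∧
    -- For all `y`, `yt`: the law of `Q[g]` for `g` distributed as the updated posterior process.
    (∀ (y : Fin n → ℝ) (yt : ℝ) (g : Cube d → Ω → ℝ),
      IsGP g P (postMean k σ (append X xt) (append y yt)) (postCov k σ (append X xt)) →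
      (∀ᵐ ω ∂P, Integrable fun x => g x ω * p x) ∧
      IsNormal (P.map fun ω => qoi p fun x => g x ω)
        (mu2 k p σ X y xt yt) (sigma2Sq k p σ X xt)) ∧
    -- The squared-exponential kernel with the uniform density on `[0, 1]^d`: it is covered by the
    -- hypotheses above, and `ε` and `σ_0²` are explicit.
    (∀ (s : ℝ) (ℓ : Fin d → ℝ), (∀ j, 0 < ℓ j) →
      IsDensity (fun _ : Cube d => (1 : ℝ)) ∧
      IsCovarianceFunction (sqExpKernel s ℓ) (fun _ => 1) ∧
      (∀ x : Cube d, eps (sqExpKernel s ℓ) (fun _ => 1) x =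
        s ^ 2 * (Real.pi / 2) ^ ((d : ℝ) / 2) *
          ∏ j, (ℓ j * (erf ((1 - (x j : ℝ)) / (Real.sqrt 2 * ℓ j)) -
            erf (-(x j : ℝ) / (Real.sqrt 2 * ℓ j))))) ∧
      sigma0Sq (sqExpKernel s ℓ) (fun _ : Cube d => (1 : ℝ)) =
        s ^ 2 * ∏ j, (2 * ℓ j ^ 2 * Real.sqrt Real.pi *
          (-1 / Real.sqrt Real.pi + 1 / Real.sqrt Real.pi * Real.exp (-1 / (2 * ℓ j ^ 2)) +
            1 / (Real.sqrt 2 * ℓ j) * erf (1 / (Real.sqrt 2 * ℓ j))))) := by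
  have hπ := hp.isProbabilityMeasure
  refine ⟨⟨fun y => ?_, ?_⟩, fun f Y hf hY => ⟨?_, ?_⟩, fun y g hg => ?_,
    ⟨hk.postMean_append hσ X xt, hk.postCov_append hσ X xt, fun y yt => ?_, ?_⟩,
    fun f Y Yt hf hY => ?_, fun y yt g hg => ?_, fun s ℓ hℓ => ?_⟩
  · rw [← hp.integral_densityMeasure, integral_postMean hk hp]
  · rw [hp.integral_integral_densityMeasure, integral_integral_postCov hk hp hσ]
  · exact hf.ae_integrable hp MemLp.zero' (hk.integrable_diag_densityMeasure hp)
  · exact hY.condDistrib_qoi hp hk hσ hf measurable_id measurable_id fun _ => rfl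
  · exact ae_integrable_and_isNormal_of_posterior hp hk hσ X y hg
  · rw [← hp.integral_densityMeasure, integral_postMean hk hp, mu1_append hk hp hσ]
  · rw [hp.integral_integral_densityMeasure, integral_integral_postCov hk hp hσ,
      sigma1Sq_append hk hp hσ]
  -- The n + 1 observations are conditioned on jointly, with the last one split off by φ and put
  -- back by ψ.
  · have h := hY.condDistrib_qoi hp hk hσ hf
      (φ := fun y : Fin (n + 1) → ℝ => ((fun i => y i.castSucc : Fin n → ℝ), y (Fin.last n)))
      (ψ := fun z => append z.1 z.2) (by fun_prop) measurable_append
      fun y => Fin.snoc_init_self (α := fun _ => ℝ) y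
    simpa only [append_castSucc, append_last, mu1_append hk hp hσ, sigma1Sq_append hk hp hσ]
      using h
  · rw [← mu1_append hk hp hσ, ← sigma1Sq_append hk hp hσ]
    exact ae_integrable_and_isNormal_of_posterior hp hk hσ _ _ hg
  · exact ⟨isDensity_one, isCovarianceFunction_sqExpKernel s ℓ, eps_sqExpKernel s hℓ,
      sigma0Sq_sqExpKernel s hℓ⟩
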